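/- Let $R$ be any ring (associative, with identity). Let $\mathrm{Ch}(R)$ be the category of $\mathbb{Z}$-indexed chain complexes of left $R$-modules, and $\mathrm{Ch}(\mathrm{Ch}(R))$ the category of $\mathbb{Z}$-indexed chain complexes of objects of $\mathrm{Ch}(R)$. Let $\mathcal{C}$ be the class of all complexes of projective complexes, that is, of all $\mathbb{C} \in \mathrm{Ch}(\mathrm{Ch}(R))$ such that each component $\mathbb{C}_n$ is a projective object of $\mathrm{Ch}(R)$. Call $\mathbb{Y} \in \mathrm{Ch}(\mathrm{Ch}(R))$ pure exact if the complex of abelian groups $\cdots \to \mathrm{Hom}_{\mathrm{Ch}(R)}(F,\mathbb{Y}_{n}) \to \mathrm{Hom}_{\mathrm{Ch}(R)}(F,\mathbb{Y}_{n-1}) \to \cdots$ is exact for every finitely presented object $F$ of $\mathrm{Ch}(R)$. For $\mathbb{X}, \mathbb{Y} \in \mathrm{Ch}(\mathrm{Ch}(R))$ let $\mathrm{Hom}(\mathbb{X},\mathbb{Y})$ be the complex of abelian groups with $\mathrm{Hom}(\mathbb{X},\mathbb{Y})_n = \prod_{k\in\mathbb{Z}} \mathrm{Hom}_{\mathrm{Ch}(R)}(\mathbb{X}_k,\mathbb{Y}_{k+n})$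 and differential $(\delta_n f)_k = d_{k+n} f_k - (-1)^n f_{k-1} d_k$. Let $\mathcal{C}^{\perp}$ be the class of all $\mathbb{Y} \in \mathrm{Ch}(\mathrm{Ch}(R))$ such that $\mathrm{Ext}^1_{\mathrm{Ch}(\mathrm{Ch}(R))}(\mathbb{C},\mathbb{Y}) = 0$ for all $\mathbb{C} \in \mathcal{C}$. If $\mathbb{Y}$ is pure exact, then $\mathrm{Hom}(\mathbb{C},\mathbb{Y})$ is exact for every $\mathbb{C} \in \mathcal{C}$, and $\mathbb{Y} \in \mathcal{C}^{\perp}$. These two conclusions are equivalent: for every $\mathbb{Y} \in \mathrm{Ch}(\mathrm{Ch}(R))$, pure exact or not, $\mathrm{Hom}(\mathbb{C},\mathbb{Y})$ is exact for all $\mathbb{C} \in \mathcal{C}$ if and only if $\mathbb{Y} \in \mathcal{C}^{\perp}$. -/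

import Mathlib

open CategoryTheory

universe v u

namespace PureComplexes

/-- The complex of abelian groups `Hom(X, Y)` of two `ℤ`-indexed chain complexes over a
preadditive category. In degree `n` it is `∏ k, Hom(X_k, Y_{k+n})`, and its differential is
`(δ_n f)_k = d_{k+n} f_k - (-1)^n f_{k-1} d_k`.

The differential from degree `i` to degree `j` is given by one formula for all `i` and `j`, in
which `k + j - i` is `k - 1` when `j = i - 1`; for any other `j` both differentials that occur
in it vanish. The isomorphism `Y.XIsoOfEq` is the identification `Y_{k+j-i+i} = Y_{k+j}`. -/
noncomputable def homComplex {A : Type u} [Category.{v} A] [Preadditive A]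
    (X Y : ChainComplex A ℤ) : ChainComplex AddCommGrpCat.{v} ℤ where
  X n := AddCommGrpCat.of (∀ k : ℤ, X.X k ⟶ Y.X (k + n))
  d i j := AddCommGrpCat.ofHom
    { toFun := fun f k => f k ≫ Y.d (k + i) (k + j) -
        i.negOnePow • (X.d k (k + j - i) ≫ f (k + j - i) ≫
          (Y.XIsoOfEq (show k + j - i + i = k + j by lia)).hom)
      map_zero' := by
        funext k
        simp
      map_add' := by
        intro f g
        funext k
        simp only [Pi.add_apply, Preadditive.add_comp, Preadditive.comp_add, smul_add]
        abel }
  shape i j hij := by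
    have hij' : ¬ (j + 1 = i) := hij
    ext f k
    have h₁ : Y.d (k + i) (k + j) = 0 := Y.shape _ _ (by simp; lia)
    have h₂ : X.d k (k + j - i) = 0 := X.shape _ _ (by simp; lia)
    simp [h₁, h₂]
    rfl
  d_comp_d' i j l hij hjl := by
    have hij' : j + 1 = i := hij
    have hjl' : l + 1 = j := hjl
    ext f k
    have key : ∀ (a b : ℤ) (_ : a = b) (ha : a + i = k + j) (hb : b + j = k + l),
        X.d k a ≫ f a ≫ (Y.XIsoOfEq ha).hom ≫ Y.d (k + j) (k + l) =
          X.d k b ≫ f b ≫ Y.d (b + i) (b + j) ≫ (Y.XIsoOfEq hb).hom := by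
      rintro a _ rfl ha hb
      simp
    have hk := key (k + j - i) (k + l - j) (by lia) (by lia) (by lia)
    have hs : j.negOnePow = - i.negOnePow := by
      rw [← hij', Int.negOnePow_succ, neg_neg]
    simp only [AddCommGrpCat.hom_comp, AddCommGrpCat.hom_ofHom, AddMonoidHom.comp_apply,
      AddMonoidHom.coe_mk, ZeroHom.coe_mk, AddCommGrpCat.hom_zero, AddMonoidHom.zero_apply,
      Preadditive.sub_comp, Preadditive.comp_sub, Linear.units_smul_comp,
      Linear.comp_units_smul, Category.assoc, HomologicalComplex.d_comp_d,
      HomologicalComplex.d_comp_d_assoc, Limits.comp_zero, Limits.zero_comp, smul_zero,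
      zero_sub, sub_zero, hs, hk]
    simp
    rfl

/-- The objects `C` of `Ch(A)` all of whose components `C_n` are projective in `A`. For
`A = Ch(R)` these are the complexes of projective complexes. -/
def componentwiseProjective (A : Type u) [Category.{v} A] [Abelian A] :
    ObjectProperty (ChainComplex A ℤ) :=
  fun C => ∀ n : ℤ, Projective (C.X n)

/-- A complex `Y` over `A` is pure exact if the complex of abelian groups `Hom_A(F, Y)`, with
`Hom_A(F, Y_n)` in degree `n`, is exact for every finitely presented object `F` of `A`.
For `A = Ch(R)` these are the pure exact complexes of complexes. -/
def IsPureExact {A : Type u} [Category.{v} A] [Abelian A] (Y : ChainComplex A ℤ) : Prop :=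
  ∀ F : A, IsFinitelyPresentable.{v} F →
    (((preadditiveCoyoneda.obj (Opposite.op F)).mapHomologicalComplex
      (ComplexShape.down ℤ)).obj Y).Acyclic

/-- The right orthogonal of a class `P` of objects of an abelian category with respect to `Ext¹`:
the objects `Y` such that `Ext¹(C, Y) = 0` for all `C` in `P`. -/
def rightPerp {A : Type u} [Category.{v} A] [Abelian A] [HasExt.{v} A] (P : ObjectProperty A) :
    ObjectProperty A :=
  fun Y => ∀ C : A, P C → Subsingleton (Abelian.Ext.{v} C Y 1)

end PureComplexes

/-! Both conclusions are equivalent to one statement: every chain map to `Y` from a complex of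
projectives is null-homotopic.

An `n`-cycle of `Hom(C, Y)` is a chain map from a shift of `C`, and a null-homotopy of it is a
preimage under `δ`. As the class is closed under shifts, this handles exactness
(`forall_homComplex_acyclic_iff`). For `Ext¹`, the cone of the identity of a complex of projectives
is projective. It yields degreewise split extensions, along which null-homotopic maps extend
(`rightPerp_of_isNullHomotopic`, `isNullHomotopic_of_rightPerp`).

For pure exact `Y`, a projective of `Ch(R)` is a retract of a coproduct of disks, which are finitely
presented, so `C` is a retract of a complex `F` of such coproducts. Zorn's lemma extends a
null-homotopy over subcomplexes of `F` spanned by summands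
(`IsPureExact.isNullHomotopic_of_isColimit`). Each enlargement adds finitely many summands per
degree, so the obstruction is a map from a complex of finitely presented objects, treated by
`IsPureExact.isNullHomotopic_of_isFinitelyPresentable`. -/

namespace PureComplexes

open Limits

/-! ### Null-homotopic chain maps. -/

section NullHomotopic

variable {A : Type u} [Category.{v} A] [Preadditive A]

/-- A chain map is null-homotopic if it is of the form `s d + d s`. -/
def IsNullHomotopic {X Y : ChainComplex A ℤ} (f : X ⟶ Y) : Prop :=
  ∃ s : ∀ i j : ℤ, X.X i ⟶ Y.X j, ∀ i j l : ℤ, i + 1 = j → l + 1 = i →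
    f.f i = s i j ≫ Y.d j i + X.d i l ≫ s l i

lemma isNullHomotopic_iff_nonempty_homotopy {X Y : ChainComplex A ℤ} (f : X ⟶ Y) :
    IsNullHomotopic f ↔ Nonempty (Homotopy f 0) := by
  constructor
  · rintro ⟨s, hs⟩
    refine ⟨⟨fun i j => if i + 1 = j then s i j else 0, fun i j hij => if_neg hij, fun i => ?_⟩⟩
    rw [dNext_eq _ (show (ComplexShape.down ℤ).Rel i (i - 1) by simp),
      prevD_eq _ (show (ComplexShape.down ℤ).Rel (i + 1) i by simp)]
    simp [hs i (i + 1) (i - 1) rfl (by lia), add_comm]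
  · rintro ⟨h⟩
    refine ⟨h.hom, fun i j l hij hli => ?_⟩
    rw [h.comm, dNext_eq _ (show (ComplexShape.down ℤ).Rel i l from hli),
      prevD_eq _ (show (ComplexShape.down ℤ).Rel j i from hij)]
    simp [add_comm]

lemma IsNullHomotopic.comp_left {X X' Y : ChainComplex A ℤ} {f : X ⟶ Y}
    (hf : IsNullHomotopic f) (g : X' ⟶ X) : IsNullHomotopic (g ≫ f) := by
  obtain ⟨s, hs⟩ := hf
  refine ⟨fun i j => g.f i ≫ s i j, fun i j l hij hli => ?_⟩
  simp [hs i j l hij hli]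

end NullHomotopic

/-! ### Pure exactness and complexes of finitely presented objects. -/

section PureExact

variable {A : Type u} [Category.{v} A] [Abelian A]

lemma IsPureExact.exists_lift {Y : ChainComplex A ℤ} (hY : IsPureExact Y) {F : A}
    (hF : IsFinitelyPresentable.{v} F) {i j l : ℤ} (hij : j + 1 = i) (hjl : l + 1 = j)
    (g : F ⟶ Y.X j) (hg : g ≫ Y.d j l = 0) : ∃ h : F ⟶ Y.X i, h ≫ Y.d i j = g := by
  have h := hY F hF j
  rw [HomologicalComplex.exactAt_iff' _ i j l (by simpa using hij)
    ((ComplexShape.down ℤ).next_eq' hjl), ShortComplex.ab_exact_iff] at h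
  exact h g hg

attribute [local instance] Cardinal.fact_isRegular_aleph0

lemma isFinitelyPresentable_cokernel {X Y : A} (f : X ⟶ Y) (hX : IsFinitelyPresentable.{v} X)
    (hY : IsFinitelyPresentable.{v} Y) : IsFinitelyPresentable.{v} (cokernel f) := by
  have : ∀ k, IsCardinalPresentable.{v} ((parallelPair f 0).obj k) Cardinal.aleph0.{v} := by
    rintro (_ | _) <;> assumption
  exact isCardinalPresentable_of_isColimit' _ (cokernelIsCokernel f) Cardinal.aleph0.{v}
    ((hasCardinalLT_aleph0_iff _).2 inferInstance)

lemma isFinitelyPresentable_sigma {A : Type u} [Category.{v} A] {α : Type v} [Finite α] (G : α → A) [HasCoproduct G]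
    (hG : ∀ a, IsFinitelyPresentable.{v} (G a)) : IsFinitelyPresentable.{v} (∐ G) := by
  have : ∀ k, IsCardinalPresentable.{v} ((Discrete.functor G).obj k) Cardinal.aleph0.{v} :=
    fun k => hG k.as
  exact isCardinalPresentable_of_isColimit' _ (coproductIsCoproduct G) Cardinal.aleph0.{v}
    ((hasCardinalLT_aleph0_iff _).2 inferInstance)

/-- A chain map from a complex of finitely presented objects to a pure exact complex is
null-homotopic. -/
theorem IsPureExact.isNullHomotopic_of_isFinitelyPresentable {C Y : ChainComplex A ℤ}
    (hY : IsPureExact Y) (hC : ∀ n, IsFinitelyPresentable.{v} (C.X n)) (f : C ⟶ Y) :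
    IsNullHomotopic f := by
  -- There is no degree at which to start an induction, so all degrees are treated at once. With `d
  -- = q t` through the cokernels, `ψ` lifts `t f`, `s` lifts `f - q ψ`, and `w` lifts `ψ - t s`.
  -- The homotopy is `s + q w`, because `d q = 0`.
  let q (k : ℤ) := cokernel.π (C.d (k + 1) k)
  have hQ (k : ℤ) : IsFinitelyPresentable.{v} (cokernel (C.d (k + 1) k)) :=
    isFinitelyPresentable_cokernel _ (hC _) (hC _)
  let t (k l : ℤ) : cokernel (C.d (k + 1) k) ⟶ C.X l := cokernel.desc _ (C.d k l) (by simp)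
  have hqt (k l : ℤ) : q k ≫ t k l = C.d k l := by simp [q, t]
  have htd (k l m : ℤ) : t k l ≫ C.d l m = 0 := by
    rw [← cancel_epi (q k), reassoc_of% hqt k l]; simp
  have htq (k l : ℤ) (hl : l + 1 = k) : t k l ≫ q l = 0 := by
    subst hl
    rw [← cancel_epi (q (l + 1)), reassoc_of% hqt (l + 1) l]
    simp [q]
  have hψ (k : ℤ) : ∃ ψ : cokernel (C.d (k + 1) k) ⟶ Y.X k, ∀ l, l + 1 = k →
      ψ ≫ Y.d k l = t k l ≫ f.f l := by
    obtain ⟨ψ, h⟩ := hY.exists_lift (hQ k) (i := k) (j := k - 1) (l := k - 1 - 1) (by lia) (by lia)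
      (t k (k - 1) ≫ f.f (k - 1)) (by simp [reassoc_of% htd])
    refine ⟨ψ, fun l hl => ?_⟩
    obtain rfl : l = k - 1 := by lia
    exact h
  choose ψ hψ using hψ
  have hs (i j : ℤ) (hij : i + 1 = j) : ∃ s : C.X i ⟶ Y.X j, s ≫ Y.d j i = f.f i - q i ≫ ψ i :=
    hY.exists_lift (hC i) hij (show i - 1 + 1 = i by lia) _ (by
      simp [hψ i (i - 1) (by lia), reassoc_of% hqt])
  choose s hs using hs
  have hu (i j l : ℤ) (hij : i + 1 = j) (hli : l + 1 = i) :
      ∃ w : cokernel (C.d (i + 1) i) ⟶ Y.X j, w ≫ Y.d j i = ψ i - t i l ≫ s l i hli :=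
    hY.exists_lift (hQ i) hij hli _ (by
      simp [hψ i l hli, hs, reassoc_of% htq i l hli])
  choose w hw using hu
  refine ⟨fun i j => if h : i + 1 = j then s i j h + q i ≫ w i j (i - 1) h (by lia) else 0,
    fun i j l hij hli => ?_⟩
  have hq : C.d i l ≫ q l = 0 := by
    subst hli
    simp [q]
  obtain rfl : l = i - 1 := by lia
  simp only [dif_pos hij, dif_pos hli]
  simp [hs, hw, reassoc_of% hq, reassoc_of% hqt]

end PureExact

/-! ### Cycles and boundaries of the Hom complex. -/

section HomComplex

variable {A : Type u} [Category.{v} A] [Preadditive A]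

lemma homComplex_acyclic_iff (X Y : ChainComplex A ℤ) :
    (homComplex X Y).Acyclic ↔ ∀ i j l : ℤ, j + 1 = i → l + 1 = j →
      ∀ z : (∀ k : ℤ, X.X k ⟶ Y.X (k + j)), (homComplex X Y).d j l z = 0 →
        ∃ w : (∀ k : ℤ, X.X k ⟶ Y.X (k + i)), (homComplex X Y).d i j w = z := by
  rw [HomologicalComplex.acyclic_iff]
  have key (i j l : ℤ) (hij : j + 1 = i) (hjl : l + 1 = j) :=
    ((homComplex X Y).exactAt_iff' i j l (by simpa using hij)
      ((ComplexShape.down ℤ).next_eq' hjl)).trans (ShortComplex.ab_exact_iff _)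
  exact ⟨fun h i j l hij hjl => (key i j l hij hjl).1 (h j),
    fun h j => (key (j + 1) j (j - 1) rfl (by lia)).2 (h _ _ _ rfl (by lia))⟩

lemma homComplex_d_apply (X Y : ChainComplex A ℤ) (i j : ℤ)
    (z : ∀ k : ℤ, X.X k ⟶ Y.X (k + i)) (k : ℤ) :
    (show ∀ k : ℤ, X.X k ⟶ Y.X (k + j) from (homComplex X Y).d i j z) k =
      z k ≫ Y.d (k + i) (k + j) -
        i.negOnePow • (X.d k (k + j - i) ≫ z (k + j - i) ≫
          (Y.XIsoOfEq (show k + j - i + i = k + j by lia)).hom) := rfl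

/-- The element of `Hom(X, Y)_n` with the target of its components rewritten along an equality. -/
noncomputable def component {X Y : ChainComplex A ℤ} {n : ℤ} (z : ∀ k : ℤ, X.X k ⟶ Y.X (k + n))
    (k m : ℤ) (h : k + n = m) : X.X k ⟶ Y.X m :=
  z k ≫ (Y.XIsoOfEq h).hom

/-- With all four degrees as variables tied by equations, the transports along `k + j - i + i = k +
j` disappear from later arguments. -/
lemma homComplex_d_eq_iff {X Y : ChainComplex A ℤ} {i j : ℤ} (hij : j + 1 = i)
    (z : ∀ k : ℤ, X.X k ⟶ Y.X (k + i)) (w : ∀ k : ℤ, X.X k ⟶ Y.X (k + j)) :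
    (homComplex X Y).d i j z = w ↔ ∀ (k k' m m' : ℤ) (_ : k' + 1 = k) (hk : k + i = m)
      (hk' : k' + i = m') (hw : k + j = m'),
      component z k m hk ≫ Y.d m m' - i.negOnePow • (X.d k k' ≫ component z k' m' hk') =
        component w k m' hw := by
  constructor
  · rintro rfl k k' m m' h rfl h' rfl
    obtain rfl : k' = k + j - i := by lia
    have := homComplex_d_apply X Y i j z k
    simpa [component] using this.symm
  · intro h
    funext k
    have := h k (k + j - i) (k + i) (k + j) (by lia) rfl (by lia) rfl
    refine (homComplex_d_apply X Y i j z k).trans ?_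
    simpa [component] using this

/-- The complex `C` with `n` added to all degrees, its differential multiplied by `(-1)^n`. -/
@[simps]
def shiftDown (C : ChainComplex A ℤ) (n : ℤ) : ChainComplex A ℤ where
  X m := C.X (m - n)
  d i j := n.negOnePow • C.d (i - n) (j - n)
  shape i j hij := by
    rw [C.shape, smul_zero]
    simp at hij ⊢
    lia
  d_comp_d' i j l _ _ := by simp [Linear.units_smul_comp, Linear.comp_units_smul]

lemma homComplex_acyclic_of_isNullHomotopic {C Y : ChainComplex A ℤ}
    (h : ∀ (n : ℤ) (f : shiftDown C n ⟶ Y), IsNullHomotopic f) : (homComplex C Y).Acyclic := by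
  rw [homComplex_acyclic_iff]
  rintro i n l hni hln z hz
  have hz' := (homComplex_d_eq_iff hln z 0).1 hz
  let f : shiftDown C n ⟶ Y :=
    { f m := component z (m - n) m (by lia)
      comm' a b hab := by
        have hab' : b + 1 = a := hab
        have := hz' (a - n) (b - n) a b (by lia) (by lia) (by lia) (by lia)
        change component z _ _ _ ≫ Y.d a b =
          (n.negOnePow • C.d (a - n) (b - n)) ≫ component z _ _ _
        rw [Linear.units_smul_comp, ← sub_eq_zero]
        simpa [component] using this }
  obtain ⟨s, hs⟩ : ∃ s : ∀ i j : ℤ, C.X (i - n) ⟶ Y.X j, ∀ i j l : ℤ, i + 1 = j → l + 1 = i →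
      component z (i - n) i (by lia) =
        s i j ≫ Y.d j i + (n.negOnePow • C.d (i - n) (l - n)) ≫ s l i :=
    h n f
  -- The homotopy is indexed by degrees of the shifted complex; `S` reindexes it by degrees of `C`.
  let S (k m : ℤ) : C.X k ⟶ Y.X m :=
    (C.XIsoOfEq (show k = k + n - n by lia)).hom ≫ s (k + n) m
  have hS (a m : ℤ) : S (a - n) m = s a m := by
    have (b : ℤ) (hb : b = a) (hb' : a - n = b - n) :
        (C.XIsoOfEq hb').hom ≫ s b m = s a m := by
      subst hb
      simp [HomologicalComplex.XIsoOfEq]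
    exact this _ (by lia) _
  have hSc (k m : ℤ) (hk : k + i = m) : component (fun k => S k (k + i)) k m hk = S k m := by
    subst hk
    simp [component]
  refine ⟨fun k => S k (k + i), (homComplex_d_eq_iff hni _ _).2 fun k k' m m' h₁ h₂ h₃ h₄ => ?_⟩
  obtain rfl : k = m' - n := by lia
  obtain rfl : k' = m' - 1 - n := by lia
  -- Since `i = n + 1`, this sign turns the difference in `δ` into the sum in a null-homotopy.
  have hi : i.negOnePow = - n.negOnePow := by rw [← hni, Int.negOnePow_succ]
  rw [hSc, hSc, hS, hS, hs m' m (m' - 1) (by lia) (by lia), hi, Linear.units_smul_comp]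
  simp

lemma isNullHomotopic_of_homComplex_acyclic {C Y : ChainComplex A ℤ}
    (h : (homComplex C Y).Acyclic) (f : C ⟶ Y) : IsNullHomotopic f := by
  let z (k : ℤ) : C.X k ⟶ Y.X (k + 0) := f.f k ≫ (Y.XIsoOfEq (by lia)).hom
  have hzc (k m : ℤ) (h : k = m) (hk : k + 0 = m) :
      component z k m hk = f.f k ≫ (Y.XIsoOfEq h).hom := by
    simp [component, z]
  obtain ⟨w, hw⟩ := (homComplex_acyclic_iff C Y).1 h 1 0 (-1) (by lia) (by lia) z
    ((homComplex_d_eq_iff (by lia) z 0).2 fun k k' m m' h₁ h₂ h₃ h₄ => by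
      obtain rfl : k = m := by lia
      obtain rfl : k' = m' := by lia
      rw [hzc _ _ rfl, hzc _ _ rfl]
      simp [component])
  rw [homComplex_d_eq_iff (by lia)] at hw
  refine ⟨fun i j => if hij : i + 1 = j then component w i j hij else 0, fun i j l hij hli => ?_⟩
  have := hw i l j i hli hij hli (by lia)
  rw [hzc _ _ rfl] at this
  simp only [dif_pos hij, dif_pos hli]
  simpa using this.symm

end HomComplex

/-! ### Maps from finitely presented objects to coproducts. -/

section Coproduct

variable {A : Type u} [Category.{v} A] [Abelian A] {α : Type v} {G : α → A} {X : A}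
  {ι : ∀ a, G a ⟶ X} (hι : IsColimit (Cofan.mk X ι))

open Classical in
/-- The projection from a coproduct to one of its summands. -/
noncomputable def cofanProj (a : α) : X ⟶ G a :=
  Cofan.IsColimit.desc hι (fun b => if h : b = a then eqToHom (by rw [h]) else 0)

lemma ι_cofanProj_self (a : α) : ι a ≫ cofanProj hι a = 𝟙 _ := by
  exact (Cofan.IsColimit.fac hι _ a).trans (by simp)

lemma ι_cofanProj_of_ne {a b : α} (h : b ≠ a) : ι b ≫ cofanProj hι a = 0 := by
  exact (Cofan.IsColimit.fac hι _ b).trans (dif_neg h)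

/-- A coproduct is the filtered colimit of its finite subcoproducts, and `g` factors through one of
them. -/
lemma exists_finset_sum_ι [HasCoproducts.{v} A] [HasFilteredColimits A] {Z : A}
    (hZ : IsFinitelyPresentable.{v} Z) (g : Z ⟶ X) :
    ∃ T : Finset α, g = ∑ a ∈ T, (g ≫ cofanProj hι a) ≫ ι a := by
  classical
  let e : X ≅ ∐ G := hι.coconePointUniqueUpToIso (coproductIsCoproduct G)
  have he (a : α) : Sigma.ι G a ≫ e.inv = ι a :=
    hι.comp_coconePointUniqueUpToIso_inv (coproductIsCoproduct G) ⟨a⟩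
  obtain ⟨T, p, hp⟩ : ∃ (T : Finset (Discrete α)) (p : Z ⟶ ∐ fun x : T => G x.1.as),
      p ≫ Sigma.desc (fun x : T => Sigma.ι G x.1.as) = g ≫ e.hom :=
    IsFinitelyPresentable.exists_hom_of_isColimit
      (CoproductsFromFiniteFiltered.isColimitFiniteSubproductsCocone G) (g ≫ e.hom)
  let σ : (∐ fun x : T => G x.1.as) ⟶ X := Sigma.desc (fun x : T => ι x.1.as)
  have hσ : Sigma.desc (fun x : T => Sigma.ι G x.1.as) ≫ e.inv = σ := by
    refine Sigma.hom_ext _ _ fun b => ?_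
    simp [σ, he]
  have hg : g = p ≫ σ := by
    rw [← hσ, reassoc_of% hp, e.hom_inv_id, Category.comp_id]
  have hσT : σ ≫ ∑ a ∈ T.image Discrete.as, cofanProj hι a ≫ ι a = σ := by
    refine Sigma.hom_ext _ _ fun b => ?_
    simp only [σ, Sigma.ι_desc_assoc, Sigma.ι_desc]
    rw [Preadditive.comp_sum, Finset.sum_eq_single b.1.as]
    · rw [reassoc_of% ι_cofanProj_self hι]
    · intro a _ ha
      rw [← Category.assoc, ι_cofanProj_of_ne hι ha.symm, zero_comp]
    · intro hb
      exact (hb (Finset.mem_image_of_mem _ b.2)).elim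
  refine ⟨T.image Discrete.as, ?_⟩
  conv_lhs => rw [hg, ← hσT, ← Category.assoc, ← hg]
  simp [Preadditive.comp_sum]

/-- The set of indices of the summands that a morphism to a coproduct meets. -/
def support {Z : A} (g : Z ⟶ X) : Set α := {a | g ≫ cofanProj hι a ≠ 0}

lemma support_finite [HasCoproducts.{v} A] [HasFilteredColimits A] {Z : A}
    (hZ : IsFinitelyPresentable.{v} Z) (g : Z ⟶ X) : (support hι g).Finite := by
  classical
  obtain ⟨T, hT⟩ := exists_finset_sum_ι hι hZ g
  refine T.finite_toSet.subset fun a ha => ?_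
  by_contra haT
  refine ha ?_
  rw [hT, Preadditive.sum_comp]
  refine Finset.sum_eq_zero fun b hb => ?_
  rw [Category.assoc, ι_cofanProj_of_ne hι, comp_zero]
  rintro rfl
  exact haT hb

lemma comp_eq_comp_of_support [HasCoproducts.{v} A] [HasFilteredColimits A] {Z : A}
    (hZ : IsFinitelyPresentable.{v} Z) {S : Set α} (g : Z ⟶ X) (hg : support hι g ⊆ S) {W : A}
    {f f' : X ⟶ W} (h : ∀ a ∈ S, ι a ≫ f = ι a ≫ f') : g ≫ f = g ≫ f' := by
  obtain ⟨T, hT⟩ := exists_finset_sum_ι hι hZ g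
  rw [hT, Preadditive.sum_comp, Preadditive.sum_comp]
  refine Finset.sum_congr rfl fun a _ => ?_
  by_cases ha : a ∈ support hι g
  · simp [h a (hg ha)]
  · have : g ≫ cofanProj hι a = 0 := by simpa [support] using ha
    simp [this]

end Coproduct

/-! ### Extending null-homotopies over complexes of coproducts. -/

section Extension

variable {A : Type u} [Category.{v} A] [Abelian A]
  {B : ℤ → Type v} {G : ∀ n, B n → A} {F : ChainComplex A ℤ} {ι : ∀ n b, G n b ⟶ F.X n}
  (hι : ∀ n, IsColimit (Cofan.mk (F.X n) (ι n)))

/-- A family of sets of indices which spans a subcomplex of a complex of coproducts. -/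
def IsClosedUnderDifferential (S : ∀ n, Set (B n)) : Prop :=
  ∀ n, ∀ b ∈ S n, ∀ l, support (hι l) (ι n b ≫ F.d n l) ⊆ S l

lemma IsClosedUnderDifferential.union {S T : ∀ n, Set (B n)}
    (hS : IsClosedUnderDifferential hι S) (hT : IsClosedUnderDifferential hι T) :
    IsClosedUnderDifferential hι (fun n => S n ∪ T n) := by
  rintro n b (hb | hb) l
  · exact (hS n b hb l).trans Set.subset_union_left
  · exact (hT n b hb l).trans Set.subset_union_right

/-- The maps `s` are a null-homotopy of `f` on the summands in `S`. -/
def IsNullHomotopyOn (ι : ∀ n b, G n b ⟶ F.X n) {Y : ChainComplex A ℤ} (f : F ⟶ Y)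
    (S : ∀ n, Set (B n)) (s : ∀ i j : ℤ, F.X i ⟶ Y.X j) : Prop :=
  ∀ i j l : ℤ, i + 1 = j → l + 1 = i → ∀ b ∈ S i,
    ι i b ≫ f.f i = ι i b ≫ (s i j ≫ Y.d j i + F.d i l ≫ s l i)

variable [HasCoproducts.{v} A] [HasFilteredColimits A]

lemma exists_finite_isClosedUnderDifferential (hG : ∀ n b, IsFinitelyPresentable.{v} (G n b))
    (n : ℤ) (b : B n) :
    ∃ T : ∀ n, Set (B n), IsClosedUnderDifferential hι T ∧ b ∈ T n ∧ ∀ m, (T m).Finite := by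
  -- `L k` collects the summands reached from `b` in `k` steps of the differential. It lies in the
  -- single degree `n - k`, so the union over `k` is finite in each degree.
  let L (k : ℕ) : ∀ m, Set (B m) :=
    k.rec (fun m => {b' | (⟨m, b'⟩ : Σ m, B m) = ⟨n, b⟩})
      (fun _ L m => ⋃ b' ∈ L (m + 1), support (hι m) (ι (m + 1) b' ≫ F.d (m + 1) m))
  have hL (k : ℕ) (m : ℤ) :
      L (k + 1) m = ⋃ b' ∈ L k (m + 1), support (hι m) (ι (m + 1) b' ≫ F.d (m + 1) m) := rfl
  have hdeg (k : ℕ) (m : ℤ) (b' : B m) (hb' : b' ∈ L k m) : m + k = n := by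
    induction k generalizing m with
    | zero =>
      have : (⟨m, b'⟩ : Σ m, B m) = ⟨n, b⟩ := hb'
      simpa using congrArg Sigma.fst this
    | succ k hk =>
      rw [hL] at hb'
      simp only [Set.mem_iUnion] at hb'
      obtain ⟨c, hc, _⟩ := hb'
      have := hk _ c hc
      push_cast
      lia
  have hfin (k : ℕ) (m : ℤ) : (L k m).Finite := by
    induction k generalizing m with
    | zero =>
      refine Set.Subsingleton.finite fun c hc c' hc' => ?_
      have : (⟨m, c⟩ : Σ m, B m) = ⟨m, c'⟩ :=
        (show (⟨m, c⟩ : Σ m, B m) = ⟨n, b⟩ from hc).trans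
          (show (⟨m, c'⟩ : Σ m, B m) = ⟨n, b⟩ from hc').symm
      exact sigma_mk_injective this
    | succ k hk =>
      rw [hL]
      exact (hk _).biUnion fun c _ => support_finite (hι m) (hG _ c) _
  refine ⟨fun m => ⋃ k, L k m, fun m c hc l => ?_, Set.mem_iUnion.2 ⟨0, rfl⟩, fun m => ?_⟩
  · by_cases hl : l + 1 = m
    · subst hl
      obtain ⟨k, hk⟩ := Set.mem_iUnion.1 hc
      refine fun c' hc' => Set.mem_iUnion.2 ⟨k + 1, ?_⟩
      rw [hL]
      exact Set.mem_biUnion hk hc'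
    · intro c' hc'
      refine (hc' ?_).elim
      rw [F.shape _ _ hl, comp_zero, zero_comp]
  · refine (hfin (n - m).toNat m).subset fun c hc => ?_
    obtain ⟨k, hk⟩ := Set.mem_iUnion.1 hc
    have := hdeg k m c hk
    obtain rfl : k = (n - m).toNat := by lia
    exact hk

lemma IsNullHomotopyOn.exists_extension (hG : ∀ n b, IsFinitelyPresentable.{v} (G n b))
    {Y : ChainComplex A ℤ} (hY : IsPureExact Y) {f : F ⟶ Y} {S T : ∀ n, Set (B n)}
    (hS : IsClosedUnderDifferential hι S) (hT : IsClosedUnderDifferential hι T)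
    (hTf : ∀ n, (T n).Finite) {s : ∀ i j : ℤ, F.X i ⟶ Y.X j} (hs : IsNullHomotopyOn ι f S s) :
    ∃ s' : ∀ i j : ℤ, F.X i ⟶ Y.X j, IsNullHomotopyOn ι f (fun n => S n ∪ T n) s' ∧
      ∀ i j, ∀ b ∈ S i, ι i b ≫ s i j = ι i b ≫ s' i j := by
  classical
  -- `U` indexes the quotient of the subcomplex of `S ∪ T` by that of `S`. Once the null-homotopic
  -- map of `s` is subtracted, `f` vanishes on `S` and so induces a map on this quotient.
  let U (n : ℤ) : Set (B n) := T n \ S n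
  have hUf (n : ℤ) : Finite (U n) := ((hTf n).subset Set.sdiff_subset).to_subtype
  let incl (n : ℤ) : (∐ fun b : U n => G n b) ⟶ F.X n := Sigma.desc (fun b => ι n b)
  let proj (n : ℤ) : F.X n ⟶ (∐ fun b : U n => G n b) := Cofan.IsColimit.desc (hι n)
    (fun b => if h : b ∈ U n then Sigma.ι (fun b : U n => G n b) ⟨b, h⟩ else 0)
  have hincl (n : ℤ) (b : U n) : Sigma.ι (fun b : U n => G n b) b ≫ incl n = ι n b := by
    simp [incl]
  have hproj (n : ℤ) (b : B n) (h : b ∈ U n) :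
      ι n b ≫ proj n = Sigma.ι (fun b : U n => G n b) ⟨b, h⟩ :=
    (Cofan.IsColimit.fac (hι n) _ b).trans (dif_pos h)
  have hproj' (n : ℤ) (b : B n) (h : b ∉ U n) : ι n b ≫ proj n = 0 :=
    (Cofan.IsColimit.fac (hι n) _ b).trans (dif_neg h)
  have hST := hS.union hι hT
  -- Projecting to `U` discards only components in `S`, as `S ∪ T` is closed, and `φ` kills those.
  have key (n l : ℤ) {W : A} (φ : F.X l ⟶ W) (hφ : ∀ b ∈ S l, ι l b ≫ φ = 0) :
      incl n ≫ F.d n l ≫ proj l ≫ incl l ≫ φ = incl n ≫ F.d n l ≫ φ := by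
    refine Sigma.hom_ext _ _ fun b => ?_
    rw [reassoc_of% hincl, reassoc_of% hincl, ← Category.assoc, ← Category.assoc (ι n b)]
    refine comp_eq_comp_of_support (hι l) (hG n b) _ (hST n b (Or.inr b.2.1) l) fun c hc => ?_
    by_cases hcS : c ∈ S l
    · rw [reassoc_of% hproj' l c (fun h => h.2 hcS), hφ c hcS, zero_comp]
    · rw [reassoc_of% hproj l c ⟨hc.resolve_left hcS, hcS⟩, reassoc_of% hincl]
  have hSd (n l : ℤ) (b : B n) (hb : b ∈ S n) : ι n b ≫ F.d n l ≫ proj l = 0 := by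
    rw [← Category.assoc, ← comp_zero (f := ι n b ≫ F.d n l)]
    refine comp_eq_comp_of_support (hι l) (hG n b) _ (hS n b hb l) fun c hc => ?_
    rw [comp_zero, hproj' l c fun h => h.2 hc]
  let C : ChainComplex A ℤ :=
    { X n := ∐ fun b : U n => G n b
      d n l := incl n ≫ F.d n l ≫ proj l
      shape n l h := by rw [F.shape n l h, zero_comp, comp_zero]
      d_comp_d' n l m _ _ := by
        simp only [Category.assoc]
        rw [key n l (F.d l m ≫ proj m) (hSd l m)]
        simp }
  let f' : F ⟶ Y := f - Homotopy.nullHomotopicMap s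
  have hf' (i j l : ℤ) (hij : i + 1 = j) (hli : l + 1 = i) :
      f'.f i = f.f i - (s i j ≫ Y.d j i + F.d i l ≫ s l i) := by
    dsimp [f']
    rw [Homotopy.nullHomotopicMap_f (k₂ := j) (k₁ := i) (k₀ := l) hij hli, add_comm]
  have hf'S (i : ℤ) (b : B i) (hb : b ∈ S i) : ι i b ≫ f'.f i = 0 := by
    rw [hf' i (i + 1) (i - 1) rfl (by lia), Preadditive.comp_sub,
      hs i (i + 1) (i - 1) rfl (by lia) b hb, sub_self]
  let g : C ⟶ Y :=
    { f n := incl n ≫ f'.f n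
      comm' n l _ := by
        simp only [C, Category.assoc]
        rw [key n l (f'.f l) (hf'S l), f'.comm] }
  obtain ⟨t, ht⟩ := hY.isNullHomotopic_of_isFinitelyPresentable
    (fun n => isFinitelyPresentable_sigma (fun b : U n => G n b) fun b => hG n b) g
  refine ⟨fun i j => s i j + proj i ≫ t i j, ?_, fun i j b hb => ?_⟩
  · intro i j l hij hli b hb
    have h : ι i b ≫ f'.f i = ι i b ≫ proj i ≫ t i j ≫ Y.d j i + ι i b ≫ F.d i l ≫ proj l ≫ t l i := by
      by_cases hbS : b ∈ S i
      · rw [hf'S i b hbS, reassoc_of% hproj' i b (fun h => h.2 hbS), reassoc_of% hSd i l b hbS]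
        simp
      · have hbU : b ∈ U i := ⟨hb.resolve_left hbS, hbS⟩
        have := Sigma.ι (fun b : U i => G i b) ⟨b, hbU⟩ ≫= ht i j l hij hli
        simp only [g, C, Preadditive.comp_add, Category.assoc] at this
        rw [reassoc_of% hincl, reassoc_of% hincl] at this
        rw [this, reassoc_of% hproj i b hbU]
    rw [hf' i j l hij hli, Preadditive.comp_sub, sub_eq_iff_eq_add] at h
    rw [h]
    simp only [Preadditive.comp_add, Preadditive.add_comp, Category.assoc]
    abel
  · rw [Preadditive.comp_add, reassoc_of% hproj' i b (fun h => h.2 hb), zero_comp, add_zero]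

include hι in
/-- A chain map to a pure exact complex from a complex whose components are coproducts of finitely
presented objects is null-homotopic. -/
theorem IsPureExact.isNullHomotopic_of_isColimit
    (hG : ∀ n b, IsFinitelyPresentable.{v} (G n b)) {Y : ChainComplex A ℤ} (hY : IsPureExact Y)
    (f : F ⟶ Y) : IsNullHomotopic f := by
  classical
  let P := {p : (∀ n, Set (B n)) × (∀ i j : ℤ, F.X i ⟶ Y.X j) //
    IsClosedUnderDifferential hι p.1 ∧ IsNullHomotopyOn ι f p.1 p.2}
  let r (p q : P) : Prop := (∀ n, p.1.1 n ⊆ q.1.1 n) ∧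
    ∀ i j, ∀ b ∈ p.1.1 i, ι i b ≫ p.1.2 i j = ι i b ≫ q.1.2 i j
  have hr {p q q' : P} (h : r p q) (h' : r q q') : r p q' :=
    ⟨fun n => (h.1 n).trans (h'.1 n),
      fun i j b hb => (h.2 i j b hb).trans (h'.2 i j b (h.1 i hb))⟩
  have hchain (c : Set P) (hc : IsChain r c) : ∃ ub, ∀ a ∈ c, r a ub := by
    let S (n : ℤ) : Set (B n) := {b | ∃ p ∈ c, b ∈ p.1.1 n}
    -- The chosen member of the chain is immaterial: any two agree on the summands they share.
    let s (i j : ℤ) : F.X i ⟶ Y.X j := Cofan.IsColimit.desc (hι i) fun b =>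
      if h : b ∈ S i then ι i b ≫ h.choose.1.2 i j else 0
    have hs (p : P) (hp : p ∈ c) (i j : ℤ) (b : B i) (hb : b ∈ p.1.1 i) :
        ι i b ≫ p.1.2 i j = ι i b ≫ s i j := by
      have hbS : b ∈ S i := ⟨p, hp, hb⟩
      have h : ι i b ≫ s i j = ι i b ≫ hbS.choose.1.2 i j :=
        (Cofan.IsColimit.fac (hι i) _ b).trans (dif_pos hbS)
      rw [h]
      obtain h₁ | h₁ := eq_or_ne p hbS.choose
      · rw [← h₁]
      · obtain h₂ | h₂ := hc hp hbS.choose_spec.1 h₁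
        · exact h₂.2 i j b hb
        · exact (h₂.2 i j b hbS.choose_spec.2).symm
    refine ⟨⟨(S, s), fun n b hb l c' hc' => ?_, fun i j l hij hli b hb => ?_⟩,
      fun p hp => ⟨fun n b hb => ⟨p, hp, hb⟩, hs p hp⟩⟩
    · obtain ⟨p, hp, hb⟩ := hb
      exact ⟨p, hp, p.2.1 n b hb l hc'⟩
    · obtain ⟨p, hp, hb⟩ := hb
      rw [p.2.2 i j l hij hli b hb, Preadditive.comp_add, Preadditive.comp_add,
        reassoc_of% hs p hp i j b hb]
      congr 1
      rw [← Category.assoc, ← Category.assoc]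
      exact comp_eq_comp_of_support (hι l) (hG i b) _ (p.2.1 i b hb l) (hs p hp l i)
  -- `r` is only a preorder: maximality says that any extension of `p` is again below `p`, which
  -- already bounds its index sets.
  obtain ⟨p, hp⟩ := exists_maximal_of_chains_bounded hchain hr
  have hmem (n : ℤ) (b : B n) : b ∈ p.1.1 n := by
    obtain ⟨T, hT, hbT, hTf⟩ := exists_finite_isClosedUnderDifferential hι hG n b
    obtain ⟨s', hs', h⟩ := p.2.2.exists_extension hι hG hY p.2.1 hT hTf
    exact (hp ⟨(_, s'), p.2.1.union hι hT, hs'⟩ ⟨fun n => Set.subset_union_left, h⟩).1 n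
      (Or.inr hbT)
  exact ⟨p.1.2, fun i j l hij hli =>
    Cofan.IsColimit.hom_ext (hι i) _ _ fun b => p.2.2 i j l hij hli b (hmem i b)⟩

end Extension

/-! ### Disks and projective complexes of modules. -/

section Modules

attribute [local instance] Cardinal.fact_isRegular_aleph0

variable (R : Type u) [Ring R]

/-- The complex with `R` in degrees `n` and `n - 1`, and the identity as differential. -/
noncomputable def disk (n : ℤ) : ChainComplex (ModuleCat.{u} R) ℤ :=
  HomologicalComplex.double (𝟙 (ModuleCat.of R R))
    (show (ComplexShape.down ℤ).Rel n (n - 1) by simp)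

/-- Morphisms from `disk R n` to `K` are the elements of `K_n`. -/
noncomputable def diskCorepresentableBy (n : ℤ) :
    (HomologicalComplex.eval (ModuleCat.{u} R) (ComplexShape.down ℤ) n ⋙
      coyoneda.obj (Opposite.op (ModuleCat.of R R))).CorepresentableBy (disk R n) :=
  HomologicalComplex.evalCompCoyonedaCorepresentableByDoubleId _ (by lia) _

lemma isFinitelyPresentable_of : IsFinitelyPresentable.{u} (ModuleCat.of R R) := by
  rw [isFinitelyPresentable_iff_preservesFilteredColimits]
  let e : coyoneda.obj (Opposite.op (ModuleCat.of R R)) ≅ forget (ModuleCat.{u} R) :=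
    NatIso.ofComponents (fun M =>
      (ModuleCat.homEquiv.trans (LinearMap.ringLmapEquivSelf R ℕ M).toEquiv).toIso)
  have : PreservesFilteredColimits (forget (ModuleCat.{u} R)) := inferInstance
  exact ⟨fun J _ _ => preservesColimitsOfShape_of_natIso e.symm⟩

lemma isFinitelyPresentable_disk (n : ℤ) : IsFinitelyPresentable.{u} (disk R n) := by
  have : (coyoneda.obj (Opposite.op (ModuleCat.of R R))).IsCardinalAccessible Cardinal.aleph0.{u} :=
    isFinitelyPresentable_of R
  have : (HomologicalComplex.eval (ModuleCat.{u} R)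
      (ComplexShape.down ℤ) n).IsCardinalAccessible Cardinal.aleph0.{u} :=
    ⟨fun _ _ _ => inferInstance⟩
  exact Functor.isCardinalAccessible_of_natIso (diskCorepresentableBy R n).toIso.symm _

variable {R}

/-- Disks corepresent the elements in each degree, so lifting maps from disks is degreewise
surjectivity. -/
lemma epi_of_disk {X Y : ChainComplex (ModuleCat.{u} R) ℤ} (p : X ⟶ Y)
    (hp : ∀ n (g : disk R n ⟶ Y), ∃ h, h ≫ p = g) : Epi p := by
  have (n : ℤ) : Epi (p.f n) := by
    rw [ModuleCat.epi_iff_surjective]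
    intro y
    let φ : (HomologicalComplex.eval (ModuleCat.{u} R) (ComplexShape.down ℤ) n ⋙
        coyoneda.obj (Opposite.op (ModuleCat.of R R))).obj Y :=
      ModuleCat.ofHom (LinearMap.toSpanSingleton R (Y.X n) y)
    obtain ⟨h, hh⟩ := hp n ((diskCorepresentableBy R n).homEquiv.symm φ)
    let ψ : ModuleCat.of R R ⟶ X.X n := (diskCorepresentableBy R n).homEquiv h
    refine ⟨ψ.hom 1, ?_⟩
    have := (diskCorepresentableBy R n).homEquiv_comp p h
    rw [hh, Equiv.apply_symm_apply] at this
    have hφ : ψ ≫ p.f n = ModuleCat.ofHom (LinearMap.toSpanSingleton R (Y.X n) y) := this.symm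
    simpa using congrArg (fun f => f.hom 1) hφ
  exact HomologicalComplex.epi_of_epi_f p this

lemma exists_retract_coproduct (X : ChainComplex (ModuleCat.{u} R) ℤ) [Projective X] :
    ∃ (B : Type u) (G : B → ChainComplex (ModuleCat.{u} R) ℤ),
      (∀ b, IsFinitelyPresentable.{u} (G b)) ∧ Nonempty (Retract X (∐ G)) := by
  let G (b : Σ n, disk R n ⟶ X) := disk R b.1
  let p : ∐ G ⟶ X := Sigma.desc fun b => b.2
  have : Epi p := epi_of_disk p fun n g => ⟨Sigma.ι G ⟨n, g⟩, by simp [p]⟩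
  exact ⟨_, G, fun b => isFinitelyPresentable_disk R b.1,
    ⟨⟨Projective.factorThru (𝟙 X) p, p, by simp⟩⟩⟩

/-- A chain map from a complex of projective complexes to a pure exact complex is
null-homotopic. -/
theorem IsPureExact.isNullHomotopic {C Y : ChainComplex (ChainComplex (ModuleCat.{u} R) ℤ) ℤ}
    (hY : IsPureExact Y) (hC : componentwiseProjective _ C) (f : C ⟶ Y) : IsNullHomotopic f := by
  have h (n : ℤ) := have := hC n; exists_retract_coproduct (C.X n)
  choose B G hG r using h
  replace r (n : ℤ) := (r n).some
  -- The differential `r d i` squares to zero because `i r = 1`, and it makes the degreewise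
  -- retractions chain maps.
  let F : ChainComplex (ChainComplex (ModuleCat.{u} R) ℤ) ℤ :=
    { X n := ∐ G n
      d n l := (r n).r ≫ C.d n l ≫ (r l).i
      shape n l h := by rw [C.shape n l h, zero_comp, comp_zero] }
  let i : C ⟶ F := { f n := (r n).i }
  let p : F ⟶ C := { f n := (r n).r }
  have hip : i ≫ p = 𝟙 C := by
    ext1 n
    exact (r n).retract
  have := (hY.isNullHomotopic_of_isColimit (F := F) (ι := fun n => Sigma.ι (G n))
    (fun n => coproductIsCoproduct (G n)) hG (p ≫ f)).comp_left i
  rwa [reassoc_of% hip] at this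

end Modules

/-! ### Cones of identities and the vanishing of `Ext¹`. -/

section Ext

variable {A : Type u} [Category.{v} A] [Abelian A]

lemma componentwiseProjective_of_retract {C D : ChainComplex A ℤ}
    (h : ∀ n, Nonempty (Retract (C.X n) (D.X n))) (hD : componentwiseProjective A D) :
    componentwiseProjective A C := fun n =>
  have := hD n
  (h n).some.projective

/-- The mapping cone of the identity of a complex. -/
noncomputable abbrev cone (K : ChainComplex A ℤ) : ChainComplex A ℤ :=
  HomologicalComplex.homotopyCofiber (𝟙 K)

lemma componentwiseProjective_cone {K : ChainComplex A ℤ} (hK : componentwiseProjective A K) :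
    componentwiseProjective A (cone K) := fun n => by
  have := hK n
  have := hK (n - 1)
  exact Projective.of_iso (HomologicalComplex.homotopyCofiber.XIsoBiprod (𝟙 K) n (n - 1)
    (by simp)).symm inferInstance

lemma down_exists_rel (j : ℤ) : ∃ i, (ComplexShape.down ℤ).Rel i j := ⟨j + 1, by simp⟩

/-- The map from the cone of `K` to `X` defined by a family of maps `K_i ⟶ X_{i + 1}`. -/
noncomputable def coneDesc {K X : ChainComplex A ℤ}
    (h : ∀ i j : ℤ, (ComplexShape.down ℤ).Rel j i → (K.X i ⟶ X.X j)) : cone K ⟶ X :=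
  HomologicalComplex.homotopyCofiber.desc (𝟙 K) (Homotopy.nullHomotopicMap' h)
    ((Homotopy.ofEq (Category.id_comp _)).trans (Homotopy.nullHomotopy' h))

lemma inlX_coneDesc_f {K X : ChainComplex A ℤ}
    (h : ∀ i j : ℤ, (ComplexShape.down ℤ).Rel j i → (K.X i ⟶ X.X j)) (i j : ℤ)
    (hij : (ComplexShape.down ℤ).Rel j i) :
    HomologicalComplex.homotopyCofiber.inlX (𝟙 K) i j hij ≫ (coneDesc h).f j = h i j hij := by
  rw [coneDesc, HomologicalComplex.homotopyCofiber.inlX_desc_f]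
  have hij' : i + 1 = j := hij
  simp [hij']

/-- A map from the cone is a map `α` on `K` with a null-homotopy of `𝟙 K ≫ α`, and the homotopy
equation recovers `α`. -/
lemma cone_hom_ext {K X : ChainComplex A ℤ} {f g : cone K ⟶ X}
    (h : ∀ i j hij, HomologicalComplex.homotopyCofiber.inlX (𝟙 K) i j hij ≫ f.f j =
      HomologicalComplex.homotopyCofiber.inlX (𝟙 K) i j hij ≫ g.f j) : f = g := by
  apply (HomologicalComplex.homotopyCofiber.descEquiv (𝟙 K) X down_exists_rel).symm.injective
  have h' : ∀ i j : ℤ, (ComplexShape.down ℤ).Rel j i →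
    ((HomologicalComplex.homotopyCofiber.descEquiv (𝟙 K) X down_exists_rel).symm f).2.hom i j =
    ((HomologicalComplex.homotopyCofiber.descEquiv (𝟙 K) X down_exists_rel).symm g).2.hom i j := by
    intro i j hij
    simpa [HomologicalComplex.homotopyCofiber.descEquiv,
      HomologicalComplex.homotopyCofiber.inrCompHomotopy_hom _ _ _ _ hij] using h i j hij
  rw [HomologicalComplex.homotopyCofiber.descSigma_ext_iff]
  refine ⟨?_, h'⟩
  have key (x : Σ α : K ⟶ X, Homotopy (𝟙 K ≫ α) 0) (n : ℤ) :
      x.1.f n = K.d n (n - 1) ≫ x.2.hom (n - 1) n + x.2.hom n (n + 1) ≫ X.d (n + 1) n := by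
    have := x.2.comm n
    rw [dNext_eq _ (show (ComplexShape.down ℤ).Rel n (n - 1) by simp),
      prevD_eq _ (show (ComplexShape.down ℤ).Rel (n + 1) n by simp)] at this
    simpa using this
  ext n
  rw [key, key, h' _ _ (by simp), h' _ _ (by simp)]

/-- Maps from the cone are arbitrary families `K_i ⟶ X_{i+1}`, which lift one component at a time.
-/
lemma projective_cone {K : ChainComplex A ℤ} (hK : componentwiseProjective A K) :
    Projective (cone K) where
  factors {E X} f e he := by
    refine ⟨coneDesc fun i j hij => (hK i).factorThru
      (HomologicalComplex.homotopyCofiber.inlX (𝟙 K) i j hij ≫ f.f j) (e.f j), ?_⟩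
    refine cone_hom_ext fun i j hij => ?_
    rw [HomologicalComplex.comp_f, ← Category.assoc, inlX_coneDesc_f]
    simp

lemma exists_epi_of_projective {C : ChainComplex A ℤ} (hC : componentwiseProjective A C) :
    ∃ (P : ChainComplex A ℤ) (p : P ⟶ C),
      Projective P ∧ componentwiseProjective A P ∧ Epi p := by
  let K : ChainComplex A ℤ := { X n := C.X (n + 1), d _ _ := 0 }
  have hK : componentwiseProjective A K := fun n => hC (n + 1)
  let p : cone K ⟶ C := coneDesc fun i j hij => (C.XIsoOfEq hij).hom
  refine ⟨cone K, p, projective_cone hK, componentwiseProjective_cone hK, ?_⟩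
  refine HomologicalComplex.epi_of_epi_f p fun n => ?_
  have hn : (ComplexShape.down ℤ).Rel n (n - 1) := by simp
  have := inlX_coneDesc_f (K := K) (X := C) (fun i j hij => (C.XIsoOfEq hij).hom) (n - 1) n hn
  have h2 : Epi (HomologicalComplex.homotopyCofiber.inlX (𝟙 K) (n - 1) n hn ≫ p.f n) := by
    rw [this]
    exact inferInstanceAs (Epi (C.XIsoOfEq hn).hom)
  exact epi_of_epi (HomologicalComplex.homotopyCofiber.inlX (𝟙 K) (n - 1) n hn) _

/-- Null-homotopic chain maps extend along degreewise split monomorphisms. -/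
lemma IsNullHomotopic.exists_extension {K P Y : ChainComplex A ℤ} {k : K ⟶ P}
    (hk : ∀ n, IsSplitMono (k.f n)) {f : K ⟶ Y} (hf : IsNullHomotopic f) :
    ∃ g : P ⟶ Y, k ≫ g = f := by
  obtain ⟨s, hs⟩ := hf
  -- The retractions need not commute with differentials: any family of maps defines a
  -- null-homotopic chain map.
  refine ⟨Homotopy.nullHomotopicMap fun i j => retraction (k.f i) ≫ s i j, ?_⟩
  rw [Homotopy.comp_nullHomotopicMap]
  ext n
  rw [Homotopy.nullHomotopicMap_f (k₂ := n + 1) (k₁ := n) (k₀ := n - 1) (by simp) (by simp),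
    hs n (n + 1) (n - 1) (by lia) (by lia)]
  simp [add_comm]

open Abelian in
/-- If all chain maps from complexes of projectives to `Y` are null-homotopic, then `Y` is in the
right orthogonal of the class of complexes of projectives. -/
lemma rightPerp_of_isNullHomotopic [HasExt.{v} (ChainComplex A ℤ)] {Y : ChainComplex A ℤ}
    (h : ∀ C, componentwiseProjective A C → ∀ f : C ⟶ Y, IsNullHomotopic f) :
    rightPerp (componentwiseProjective A) Y := by
  intro C hC
  obtain ⟨P, p, hP, hP', hp⟩ := exists_epi_of_projective hC
  let S := ShortComplex.mk (kernel.ι p) p (kernel.condition p)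
  have hS : S.ShortExact := { exact := ShortComplex.exact_of_f_is_kernel _ (kernelIsKernel p) }
  have hsplit (n : ℤ) : Nonempty (S.map (HomologicalComplex.eval A _ n)).Splitting := by
    have : Projective (S.map (HomologicalComplex.eval A _ n)).X₃ := hC n
    exact ⟨(HomologicalComplex.shortExact_iff_degreewise_shortExact S).1 hS n
      |>.splittingOfProjective⟩
  have hK : componentwiseProjective A S.X₁ :=
    componentwiseProjective_of_retract (fun n => ⟨⟨_, _, (hsplit n).some.f_r⟩⟩) hP'
  refine subsingleton_of_forall_eq 0 fun x => ?_
  -- As `P` is projective, every class comes from a map on the kernel. That map extends to `P`, so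
  -- its product with the extension class is zero.
  obtain ⟨y, rfl⟩ := Ext.contravariant_sequence_exact₃ hS Y x (Ext.eq_zero_of_projective _)
    (add_zero 1)
  obtain ⟨f, rfl⟩ := Ext.addEquiv₀.symm.surjective y
  obtain ⟨g, rfl⟩ := (h _ hK f).exists_extension (k := S.f) fun n => (hsplit n).some.isSplitMono_f
  rw [Ext.addEquiv₀_symm_apply, ← Ext.mk₀_comp_mk₀]
  exact hS.extClass_comp_assoc _

open Abelian in
/-- If `Y` is in the right orthogonal of the class of complexes of projectives, then all chain maps
from complexes of projectives to `Y` are null-homotopic. -/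
lemma isNullHomotopic_of_rightPerp [HasExt.{v} (ChainComplex A ℤ)] {Y : ChainComplex A ℤ}
    (hY : rightPerp (componentwiseProjective A) Y) {K : ChainComplex A ℤ}
    (hK : componentwiseProjective A K) (f : K ⟶ Y) : IsNullHomotopic f := by
  let k : K ⟶ cone K := HomologicalComplex.homotopyCofiber.inr (𝟙 K)
  have hk (n : ℤ) : k.f n ≫ HomologicalComplex.homotopyCofiber.sndX (𝟙 K) n = 𝟙 (K.X n) :=
    HomologicalComplex.homotopyCofiber.inrX_sndX (𝟙 K) n
  have : Mono k := HomologicalComplex.mono_of_mono_f k fun n => mono_of_mono_fac (hk n)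
  let S := ShortComplex.mk k (cokernel.π k) (cokernel.condition k)
  have hS : S.ShortExact := { exact := ShortComplex.exact_of_g_is_cokernel _ (cokernelIsCokernel k) }
  have hC : componentwiseProjective A S.X₃ :=
    componentwiseProjective_of_retract (fun n => by
      have h := (HomologicalComplex.shortExact_iff_degreewise_shortExact S).1 hS n
      let s := ShortComplex.Splitting.ofExactOfRetraction _ h.exact
        (HomologicalComplex.homotopyCofiber.sndX (𝟙 K) n) (hk n) h.epi_g
      exact ⟨⟨_, _, s.s_g⟩⟩) (componentwiseProjective_cone hK)
  have := hY _ hC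
  -- Vanishing of `Ext¹` on the quotient extends `f` to the cone, and the inclusion of `K` in its
  -- cone is null-homotopic.
  obtain ⟨y, hy⟩ := Ext.contravariant_sequence_exact₁ hS Y (Ext.mk₀ f) (add_zero 1)
    (Subsingleton.elim _ _)
  obtain ⟨g, rfl⟩ := Ext.addEquiv₀.symm.surjective y
  rw [Ext.addEquiv₀_symm_apply, Ext.mk₀_comp_mk₀] at hy
  obtain rfl : k ≫ g = f := (Ext.mk₀_bijective _ _).1 hy
  rw [isNullHomotopic_iff_nonempty_homotopy]
  have H := (HomologicalComplex.homotopyCofiber.inrCompHomotopy (𝟙 K) down_exists_rel).compRight g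
  exact ⟨(Homotopy.ofEq (by simp [k])).trans (H.trans (Homotopy.ofEq zero_comp))⟩

/-- `Hom(C, Y)` is acyclic for all complexes of projectives `C` if and only if all chain maps from
complexes of projectives to `Y` are null-homotopic. -/
lemma forall_homComplex_acyclic_iff (Y : ChainComplex A ℤ) :
    (∀ C, componentwiseProjective A C → (homComplex C Y).Acyclic) ↔
      ∀ C, componentwiseProjective A C → ∀ f : C ⟶ Y, IsNullHomotopic f :=
  ⟨fun h C hC => isNullHomotopic_of_homComplex_acyclic (h C hC),
    fun h C hC => homComplex_acyclic_of_isNullHomotopic fun n =>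
      h (shiftDown C n) fun m => hC (m - n)⟩

end Ext

end PureComplexes

theorem theorem5p6 (R : Type u) [Ring R] :
    (∀ Y : ChainComplex (ChainComplex (ModuleCat.{u} R) ℤ) ℤ, PureComplexes.IsPureExact Y →
      (∀ C : ChainComplex (ChainComplex (ModuleCat.{u} R) ℤ) ℤ,
        PureComplexes.componentwiseProjective (ChainComplex (ModuleCat.{u} R) ℤ) C →
          (PureComplexes.homComplex C Y).Acyclic) ∧
      PureComplexes.rightPerp
        (PureComplexes.componentwiseProjective (ChainComplex (ModuleCat.{u} R) ℤ)) Y) ∧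
    (∀ Y : ChainComplex (ChainComplex (ModuleCat.{u} R) ℤ) ℤ,
      (∀ C : ChainComplex (ChainComplex (ModuleCat.{u} R) ℤ) ℤ,
        PureComplexes.componentwiseProjective (ChainComplex (ModuleCat.{u} R) ℤ) C →
          (PureComplexes.homComplex C Y).Acyclic) ↔
      PureComplexes.rightPerp
        (PureComplexes.componentwiseProjective (ChainComplex (ModuleCat.{u} R) ℤ)) Y) := by
  have h (Y : ChainComplex (ChainComplex (ModuleCat.{u} R) ℤ) ℤ) :=
    (PureComplexes.forall_homComplex_acyclic_iff Y).trans
      ⟨PureComplexes.rightPerp_of_isNullHomotopic,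
        fun hY _ hC => PureComplexes.isNullHomotopic_of_rightPerp hY hC⟩
  refine ⟨fun Y hY => ?_, h⟩
  have := (PureComplexes.forall_homComplex_acyclic_iff Y).2 fun _ hC => hY.isNullHomotopic hC
  exact ⟨this, (h Y).1 this⟩
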